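/- Let $R$ be a finite monoid with group of units $W$ and set of idempotents $E(R)$, ordered by $e\le f \Leftrightarrow ef=fe=e$. Let $\Lambda\subseteq E(R)$ and $S\subseteq W$ be such that $(R,\Lambda,S)$ is a (generalized) Renner-Coxeter system, that is: (i) $R$ is factorizable: $R=E(R)W=WE(R)$, and $E(R)$ is a meet semilattice under multiplication (idempotents commute); (ii) $\Lambda$ is closed under multiplication and is a transversal of $E(R)$ for the conjugation action of $W$; (iii) $(W,S)$ is a Coxeter system; (iv) for all $e\le e'$ in $E(R)$ there are $w\in W$ and $f\le f'$ in $\Lambda$ with $wew^{-1}=f$ and $we'w^{-1}=f'$; (v) with $\lambda^*(e)=\{s\in S : se=es\ne e\}$, for $e,f\in\Lambda$ the relation $e\le f$ implies $\lambda^*(e)\subseteq\lambda^*(f)$; (vi) for every $e\in\Lambda$ the groups $\{w\in W: we=ew\}$ and $\{w\in W: we=ew=e\}$ are standard parabolic subgroups of $W$; write them $W_{\lambda(e)}$ and $W_{\lambda_*(e)}$ with $\lambda(e),\lambda_*(e)\subseteq S$, where $W_I$ is the subgroup generated by $I$. Let $\le$ on $W$ be the Bruhat order. For $I\subseteq S$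 let $W^I$ (respectively ${}^IW$) be the set of $u\in W$ with $u\le v$ for all $v\in uW_I$ (respectively all $v\in W_Iu$). A left standard form of $r \in R$ is an expression $r=xey$ with $e\in\Lambda$, $x\in W^{\lambda_*(e)}$, $y\in{}^{\lambda(e)}W$; a right standard form is an expression $r=yex$ with $e\in\Lambda$, $x\in{}^{\lambda_*(e)}W$, $y\in W^{\lambda(e)}$. Every element has exactly one form of each kind. The Adherence orders on $R$ are defined as follows. - If $r=xey$ and $s=afb$ are in left standard form, then $r\le^+s$ if and only if $e\le f$ and there is $w\in W_{\lambda^*(f)}W_{\lambda_*(e)}$ with $x\le aw$ and $w^{-1}b\le y$. - If $r=yex$ and $s=bfa$ are in right standard form, then $r\le^-s$ if and only if $e\le f$ and there is $w\in W_{\lambda_*(e)}W_{\lambda^*(f)}$ with $x\le wa$ and $bw^{-1}\le y$. Let $\varepsilon\in\{+,-\}$ and let $\mathcal T$ be one of Green's relations $\mathcal J$ ($RrR=RsR$), $\mathcal L$ ($Rr=Rs$), $\mathcal R$ ($rR=sR$), or $\mathcal H=\mathcal L\cap\mathcal R$. If $r_0\le^\varepsilon r_1\le^\varepsilon\cdots\le^\varepsilon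 r_n$ is a chain in $R$ with $r_0\,\mathcal T\,r_n$, then $r_0\,\mathcal T\,r_i$ for all $0\le i\le n$. -/

import Mathlib

namespace RennerCoxeter

section CoxeterSystems

variable {W : Type*} [Group W]

/-- `(W, S)` is a Coxeter system: `W` has a Coxeter presentation whose generators are the elements
of the subset `S`. -/
def IsCoxeterSystem (S : Set W) : Prop :=
  ∃ (M : CoxeterMatrix S) (cs : CoxeterSystem M W), ∀ s : S, cs.simple s = (s : W)

/-- `l` is a reduced word for `w`: an expression of `w` as a product of elements of `S`,
of the smallest possible length. -/
def IsReducedWord (S : Set W) (l : List W) (w : W) : Prop :=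
  (∀ s ∈ l, s ∈ S) ∧ l.prod = w ∧
    ∀ l' : List W, (∀ s ∈ l', s ∈ S) → l'.prod = w → l.length ≤ l'.length

/-- The Bruhat order: some reduced word for `v` has a subword that is a reduced word for `u`. -/
def BruhatLE (S : Set W) (u v : W) : Prop :=
  ∃ l l' : List W, IsReducedWord S l v ∧ IsReducedWord S l' u ∧ l'.Sublist l

/-- The standard parabolic subgroup `W_I`. -/
def parabolic (I : Set W) : Subgroup W := Subgroup.closure I

/-- The set `^I W ^J` of the `u` that are the Bruhat minimum of their double coset
`W_I u W_J`. -/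
def minReps (S I J : Set W) : Set W :=
  {u | ∀ p ∈ parabolic I, ∀ q ∈ parabolic J, BruhatLE S u (p * u * q)}

/-- `W ^J`. -/
def minRepsRight (S J : Set W) : Set W := minReps S ∅ J

/-- `^I W`. -/
def minRepsLeft (S I : Set W) : Set W := minReps S I ∅

end CoxeterSystems

section Monoids

variable {R : Type*} [Monoid R]

/-- The order on idempotents: `e ≤ f` iff `e f = f e = e`. -/
def IdemLE (e f : R) : Prop := e * f = e ∧ f * e = e

/-- Factorizable monoid: `R = E(R) G(R) = G(R) E(R)`, and `E(R)` is a semilattice, i.e. idempotents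
commute (so that the product of two idempotents is their meet). -/
structure IsFactorizable (R : Type*) [Monoid R] : Prop where
  idem_mul_unit : ∀ r : R, ∃ (e : R) (w : Rˣ), IsIdempotentElem e ∧ r = e * w
  unit_mul_idem : ∀ r : R, ∃ (w : Rˣ) (e : R), IsIdempotentElem e ∧ r = w * e
  idem_comm : ∀ e f : R, IsIdempotentElem e → IsIdempotentElem f → e * f = f * e

/-- The type map `λ`. -/
def typeMap (S : Set Rˣ) (e : R) : Set Rˣ := {s ∈ S | (s : R) * e = e * s}

/-- The lower type map `λ_*`. -/
def lowerType (S : Set Rˣ) (e : R) : Set Rˣ := {s ∈ S | (s : R) * e = e * s ∧ e * s = e}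

/-- The upper type map `λ^*`. -/
def upperType (S : Set Rˣ) (e : R) : Set Rˣ := {s ∈ S | (s : R) * e = e * s ∧ e * s ≠ e}

/-- `(R, Λ, S)` is a (generalized) Renner-Coxeter system; the group of units of `R` is `Rˣ`. -/
structure IsRennerCoxeterSystem (Λ : Set R) (S : Set Rˣ) : Prop where
  factorizable : IsFactorizable R
  idem_of_mem : ∀ e ∈ Λ, IsIdempotentElem e
  transversal : ∀ e : R, IsIdempotentElem e →
    ∃! f : R, f ∈ Λ ∧ ∃ w : Rˣ, (w : R) * e * (w⁻¹ : Rˣ) = f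
  mul_mem : ∀ e ∈ Λ, ∀ f ∈ Λ, e * f ∈ Λ
  coxeter : IsCoxeterSystem S
  conj_pair : ∀ e e' : R, IsIdempotentElem e → IsIdempotentElem e' → IdemLE e e' →
    ∃ w : Rˣ, ∃ f ∈ Λ, ∃ f' ∈ Λ, IdemLE f f' ∧
      (w : R) * e * (w⁻¹ : Rˣ) = f ∧ (w : R) * e' * (w⁻¹ : Rˣ) = f'
  upperType_mono : ∀ e ∈ Λ, ∀ f ∈ Λ, IdemLE e f → upperType S e ⊆ upperType S f
  commutant_parabolic : ∀ e ∈ Λ, ∃ I ⊆ S, ∀ w : Rˣ,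
    (w : R) * e = e * w ↔ w ∈ parabolic I
  stabilizer_parabolic : ∀ e ∈ Λ, ∃ I ⊆ S, ∀ w : Rˣ,
    ((w : R) * e = e * w ∧ e * w = e) ↔ w ∈ parabolic I

/-- The set `λ(e)` defined above satisfies the defining property of the type map:
`W_{λ(e)}` is the set of the units `w` with `w e = e w`. -/
theorem IsRennerCoxeterSystem.mem_parabolic_typeMap {Λ : Set R} {S : Set Rˣ}
    (h : IsRennerCoxeterSystem Λ S) {e : R} (he : e ∈ Λ) (w : Rˣ) :
    w ∈ parabolic (typeMap S e) ↔ (w : R) * e = e * w := by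
  obtain ⟨I, hIS, hI⟩ := h.commutant_parabolic e he
  rw [hI]
  have h1 : typeMap S e ⊆ parabolic I := fun s hs => (hI s).1 hs.2
  have h2 : I ⊆ typeMap S e := fun s hs => ⟨hIS hs, (hI s).2 (Subgroup.subset_closure hs)⟩
  exact ⟨fun hw => (Subgroup.closure_le _).2 h1 hw, fun hw => Subgroup.closure_mono h2 hw⟩

/-- Likewise `W_{λ_*(e)}` is the set of the units `w` with `w e = e w = e`. -/
theorem IsRennerCoxeterSystem.mem_parabolic_lowerType {Λ : Set R} {S : Set Rˣ}
    (h : IsRennerCoxeterSystem Λ S) {e : R} (he : e ∈ Λ) (w : Rˣ) :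
    w ∈ parabolic (lowerType S e) ↔ ((w : R) * e = e * w ∧ e * w = e) := by
  obtain ⟨I, hIS, hI⟩ := h.stabilizer_parabolic e he
  rw [hI]
  have h1 : lowerType S e ⊆ parabolic I := fun s hs => (hI s).1 hs.2
  have h2 : I ⊆ lowerType S e := fun s hs => ⟨hIS hs, (hI s).2 (Subgroup.subset_closure hs)⟩
  exact ⟨fun hw => (Subgroup.closure_le _).2 h1 hw, fun hw => Subgroup.closure_mono h2 hw⟩

/-- `r = x e y` is in left standard form. -/
def IsLeftStd (Λ : Set R) (S : Set Rˣ) (r : R) (x : Rˣ) (e : R) (y : Rˣ) : Prop :=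
  r = x * e * y ∧ e ∈ Λ ∧ x ∈ minRepsRight S (lowerType S e) ∧ y ∈ minRepsLeft S (typeMap S e)

/-- `r = y e x` is in right standard form. -/
def IsRightStd (Λ : Set R) (S : Set Rˣ) (r : R) (y : Rˣ) (e : R) (x : Rˣ) : Prop :=
  r = y * e * x ∧ e ∈ Λ ∧ x ∈ minRepsLeft S (lowerType S e) ∧ y ∈ minRepsRight S (typeMap S e)

/-- The Adherence order `≤⁺`; the element `u * v` runs through `W_{λ^*(f)} W_{λ_*(e)}`. -/
def AdhPlus (Λ : Set R) (S : Set Rˣ) (r s : R) : Prop :=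
  ∃ (x : Rˣ) (e : R) (y a : Rˣ) (f : R) (b : Rˣ),
    IsLeftStd Λ S r x e y ∧ IsLeftStd Λ S s a f b ∧ IdemLE e f ∧
    ∃ u ∈ parabolic (upperType S f), ∃ v ∈ parabolic (lowerType S e),
      BruhatLE S x (a * (u * v)) ∧ BruhatLE S ((u * v)⁻¹ * b) y

/-- The Adherence order `≤⁻`; the element `u * v` runs through `W_{λ_*(e)} W_{λ^*(f)}`. -/
def AdhMinus (Λ : Set R) (S : Set Rˣ) (r s : R) : Prop :=
  ∃ (y : Rˣ) (e : R) (x b : Rˣ) (f : R) (a : Rˣ),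
    IsRightStd Λ S r y e x ∧ IsRightStd Λ S s b f a ∧ IdemLE e f ∧
    ∃ u ∈ parabolic (lowerType S e), ∃ v ∈ parabolic (upperType S f),
      BruhatLE S x (u * v * a) ∧ BruhatLE S (b * (u * v)⁻¹) y

/-- Green's relation `J`: `R r R = R s R`. -/
def GreenJ (r s : R) : Prop := {t : R | ∃ p q : R, t = p * r * q} = {t : R | ∃ p q : R, t = p * s * q}

/-- Green's relation `L`: `R r = R s`. -/
def GreenL (r s : R) : Prop := {t : R | ∃ p : R, t = p * r} = {t : R | ∃ p : R, t = p * s}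

/-- Green's relation `R`: `r R = s R`. -/
def GreenR (r s : R) : Prop := {t : R | ∃ q : R, t = r * q} = {t : R | ∃ q : R, t = s * q}

/-- Green's relation `H`. -/
def GreenH (r s : R) : Prop := GreenL r s ∧ GreenR r s

end Monoids

end RennerCoxeter

/-! Let `r = x e y` with `e ∈ Λ`, and let `H = W_{λ(e)}` be the group of units commuting with `e`.
The `J`-class of `r` amounts to `e`, its `R`-class to `e` with the coset `x H`, its `L`-class to `e`
with the coset `H y`. That these data are determined by the classes rests on commuting idempotents,
finiteness and the transversal property (`eq_of_greenJ`, `commute_of_greenR`, `commute_of_greenL`).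

Both Adherence orders move these data in one direction only. The idempotent can only grow. While it
stays equal to `e`, the auxiliary unit `w` lies in `H`, so the Bruhat comparisons descend to
comparisons of cosets of `H`. A chain whose ends carry the same data therefore carries constant
data.

The comparison of cosets is `CosetLE`: equal cosets, or strictly smaller minimal length. It is
transitive, antisymmetric on cosets, and implied by the Bruhat order (`ReflectionStep.cosetLE`, via
strong exchange). `LexRel` combines it with the order on `Λ`. Transitivity is proved for `LexRel`,
so none is needed for the Adherence orders themselves; `green_chain` concludes. -/

namespace CoxeterSystem

variable {B W : Type*} [Group W] {M : CoxeterMatrix B} (cs : CoxeterSystem M W)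

/-! ### Strong exchange, from the action of `W` on signed reflections. -/

section StrongExchange

open Classical in
/-- The involution `(t, ε) ↦ (sᵢ t sᵢ, ε + [t = sᵢ])` of `W × ℤ/2`. -/
noncomputable def signedConj (i : B) : Equiv.Perm (W × ZMod 2) :=
  Function.Involutive.toPerm
    (fun p => (cs.simple i * p.1 * cs.simple i, p.2 + if p.1 = cs.simple i then 1 else 0)) (by
      rintro ⟨t, ε⟩
      have h : cs.simple i * t * cs.simple i = cs.simple i ↔ t = cs.simple i := by
        rw [mul_assoc, mul_eq_left, mul_eq_one_iff_eq_inv, inv_simple]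
      simp only [h, Prod.mk.injEq]
      refine ⟨by simp [mul_assoc], ?_⟩
      rw [add_assoc, CharTwo.add_self_eq_zero, add_zero])

open Classical in
theorem signedConj_apply (i : B) (t : W) (ε : ZMod 2) :
    cs.signedConj i (t, ε) =
      (cs.simple i * t * cs.simple i, ε + if t = cs.simple i then 1 else 0) := rfl

-- The elements `(sⱼ sᵢ)^k sⱼ` with `k < 2n` form the right inversion sequence of the alternating
-- word `(sᵢ sⱼ)^n`; the sign counts how often `t` occurs among them.
open Classical in
theorem signedConj_mul_pow_apply (i j : B) (n : ℕ) (t : W) (ε : ZMod 2) :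
    ((cs.signedConj i * cs.signedConj j) ^ n) (t, ε) =
      ((cs.simple i * cs.simple j) ^ n * t * (cs.simple j * cs.simple i) ^ n,
        ε + ∑ k ∈ Finset.range (2 * n),
          if t = (cs.simple j * cs.simple i) ^ k * cs.simple j then 1 else 0) := by
  induction n with
  | zero => simp
  | succ n ih =>
    have hinv : (cs.simple i * cs.simple j)⁻¹ = cs.simple j * cs.simple i := by simp
    have hswap : cs.simple j * (cs.simple i * cs.simple j) ^ n =
        (cs.simple j * cs.simple i) ^ n * cs.simple j := by
      have : SemiconjBy (cs.simple j) (cs.simple i * cs.simple j)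
        (cs.simple j * cs.simple i) := by simp [SemiconjBy, mul_assoc]
      exact (this.pow_right n).eq
    have hconj : ∀ u : W, (cs.simple i * cs.simple j) ^ n * t *
        (cs.simple j * cs.simple i) ^ n = u ↔
        t = (cs.simple j * cs.simple i) ^ n * u * (cs.simple i * cs.simple j) ^ n := by
      intro u
      rw [← hinv, inv_pow]
      constructor
      · intro h; rw [← h]; group
      · intro h; rw [h]; group
    have h1 : (cs.simple i * cs.simple j) ^ n * t * (cs.simple j * cs.simple i) ^ n =
        cs.simple j ↔ t = (cs.simple j * cs.simple i) ^ (2 * n) * cs.simple j := by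
      rw [hconj, mul_assoc, hswap, ← mul_assoc, ← pow_add, two_mul]
    have h2 : cs.simple j * ((cs.simple i * cs.simple j) ^ n * t *
        (cs.simple j * cs.simple i) ^ n) * cs.simple j = cs.simple i ↔
        t = (cs.simple j * cs.simple i) ^ (2 * n + 1) * cs.simple j := by
      have : ∀ u : W, cs.simple j * u * cs.simple j = cs.simple i ↔
          u = cs.simple j * cs.simple i * cs.simple j := by
        intro u
        constructor
        · intro h; rw [← h]; simp [mul_assoc]
        · intro h; rw [h]; simp [mul_assoc]
      rw [this, hconj, mul_assoc, mul_assoc _ (cs.simple j) (_ ^ n), hswap, ← mul_assoc,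
        ← mul_assoc, ← pow_succ, ← pow_add]
      congr! 3
      omega
    rw [pow_succ', Equiv.Perm.mul_apply, ih, Equiv.Perm.mul_apply, signedConj_apply,
      signedConj_apply, h1, h2, show 2 * (n + 1) = 2 * n + 1 + 1 by ring,
      Finset.sum_range_succ, Finset.sum_range_succ, add_assoc, add_assoc, add_assoc]
    congr 1
    rw [pow_succ', pow_succ]
    simp [mul_assoc]

/-- For `m = M i j`, the `2m` terms of the sum run twice through the same `m` elements, because `(sⱼ
sᵢ)^m = 1`; so the sign vanishes mod 2. -/
theorem isLiftable_signedConj : M.IsLiftable cs.signedConj := by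
  classical
  intro i j
  ext1 ⟨t, ε⟩
  rw [signedConj_mul_pow_apply, simple_mul_simple_pow, simple_mul_simple_pow', two_mul,
    Finset.sum_range_add]
  simp only [pow_add, simple_mul_simple_pow', one_mul, CharTwo.add_self_eq_zero, add_zero, mul_one,
    Equiv.Perm.one_apply]

/-- The action of `W` on `W × ℤ/2` whose second component records the parity of the number of
occurrences of a reflection in a right inversion sequence. -/
noncomputable def signedConjHom : W →* Equiv.Perm (W × ZMod 2) :=
  cs.lift ⟨cs.signedConj, cs.isLiftable_signedConj⟩

theorem signedConjHom_simple (i : B) : cs.signedConjHom (cs.simple i) = cs.signedConj i :=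
  cs.lift_apply_simple _ i

-- Since the left side depends only on the product of `ω`, so does the parity of the number of
-- occurrences of `t` in the inversion sequence.
open Classical in
theorem signedConjHom_wordProd_apply (ω : List B) (t : W) (ε : ZMod 2) :
    cs.signedConjHom (cs.wordProd ω) (t, ε) =
      (cs.wordProd ω * t * (cs.wordProd ω)⁻¹, ε + (cs.rightInvSeq ω).count t) := by
  induction ω with
  | nil => simp
  | cons i ω ih =>
    have h : cs.wordProd ω * t * (cs.wordProd ω)⁻¹ = cs.simple i ↔
        (cs.wordProd ω)⁻¹ * cs.simple i * cs.wordProd ω = t := by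
      constructor
      · intro h; rw [← h]; group
      · intro h; rw [← h]; group
    rw [wordProd_cons, map_mul, Equiv.Perm.mul_apply, ih, signedConjHom_simple, signedConj_apply, h,
      rightInvSeq, List.count_cons]
    simp [mul_assoc, add_assoc]

theorem signedConjHom_apply (w t : W) (ε : ZMod 2) :
    cs.signedConjHom w (t, ε) = (w * t * w⁻¹, ε + (cs.signedConjHom w (t, 0)).2) := by
  classical
  obtain ⟨ω, rfl⟩ := cs.wordProd_surjective w
  simp [signedConjHom_wordProd_apply]

/-- With `t = u sᵢ u⁻¹`, the sign picked up by `u⁻¹` is undone by `u`; only the middle factor `sᵢ`,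
acting on itself, contributes. -/
theorem IsReflection.signedConjHom_self {t : W} (ht : cs.IsReflection t) (ε : ZMod 2) :
    cs.signedConjHom t (t, ε) = (t, ε + 1) := by
  obtain ⟨u, i, rfl⟩ := ht
  have h1 : cs.signedConjHom u⁻¹ (u * cs.simple i * u⁻¹, ε) =
      (cs.simple i, (cs.signedConjHom u⁻¹ (u * cs.simple i * u⁻¹, ε)).2) := by
    rw [signedConjHom_apply]
    ext <;> simp [mul_assoc]
  set a := (cs.signedConjHom u⁻¹ (u * cs.simple i * u⁻¹, ε)).2
  have h2 : cs.signedConjHom u (cs.simple i, a) = (u * cs.simple i * u⁻¹, ε) := by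
    rw [← h1, ← Equiv.Perm.mul_apply, ← map_mul]
    simp
  have h3 : cs.signedConjHom (cs.simple i) (cs.simple i, a) = (cs.simple i, a + 1) := by
    rw [signedConjHom_simple, signedConj_apply]
    simp
  rw [map_mul, map_mul, Equiv.Perm.mul_apply, Equiv.Perm.mul_apply, h1, h3, signedConjHom_apply]
  rw [signedConjHom_apply] at h2
  have h4 := congrArg Prod.snd h2
  simp only at h4
  rw [add_right_comm, h4]

/-- The strong exchange property. -/
theorem IsRightInversion.mem_rightInvSeq {ω : List B} {t : W}
    (h : cs.IsRightInversion (cs.wordProd ω) t) : t ∈ cs.rightInvSeq ω := by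
  classical
  by_contra hmem
  have h0 : cs.signedConjHom (cs.wordProd ω) (t, 1) =
      (cs.wordProd ω * t * (cs.wordProd ω)⁻¹, 1) := by
    rw [signedConjHom_wordProd_apply, List.count_eq_zero_of_not_mem hmem]
    simp
  obtain ⟨ω', hω', hprod⟩ := cs.exists_isReduced (cs.wordProd ω * t)
  have h1 : cs.signedConjHom (cs.wordProd ω * t) (t, 0) =
      (cs.wordProd ω * t * (cs.wordProd ω)⁻¹, 1) := by
    rw [map_mul, Equiv.Perm.mul_apply, h.1.signedConjHom_self, zero_add, h0]
  rw [hprod, signedConjHom_wordProd_apply] at h1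
  -- The sign through `w t` is odd, so `t` occurs in the inversion sequence of a reduced word of `w
  -- t`. Then `w = (w t) t` is shorter than `w t`, against the hypothesis.
  have h2 : t ∈ cs.rightInvSeq ω' := by
    by_contra hc
    rw [List.count_eq_zero_of_not_mem hc] at h1
    simpa using congrArg Prod.snd h1
  have h3 := (cs.isRightInversion_of_mem_rightInvSeq hω' h2).2
  rw [← hprod, mul_assoc, h.1.mul_self, mul_one] at h3
  exact absurd h.2 h3.not_gt

theorem IsRightInversion.exists_eraseIdx {ω : List B} {t : W}
    (h : cs.IsRightInversion (cs.wordProd ω) t) :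
    ∃ j < ω.length, cs.wordProd ω * t = cs.wordProd (ω.eraseIdx j) := by
  obtain ⟨j, hj, rfl⟩ := List.mem_iff_getElem.mp h.mem_rightInvSeq
  refine ⟨j, by simpa using hj, ?_⟩
  rw [← wordProd_mul_getD_rightInvSeq, List.getD_eq_getElem _ 1 hj]

end StrongExchange

/-! ### Bruhat order by reflections, and its image on cosets. -/

section Bruhat

/-- One step down in the Bruhat order: `x = v t` for a right inversion `t` of `v`. -/
def ReflectionStep (x v : W) : Prop := ∃ t, cs.IsRightInversion v t ∧ x = v * t

/-- If the step is not preserved, `t` is a right inversion of `sᵢ x`. By strong exchange it is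
either the entry of the letter `i`, which gives `sᵢ x = v`, or an inversion of `x`, which
contradicts `x = v t` being shorter than `v`. -/
theorem ReflectionStep.simple_mul {x v : W} (h : cs.ReflectionStep x v) (i : B) :
    cs.ReflectionStep (cs.simple i * x) (cs.simple i * v) ∨ cs.simple i * x = v := by
  obtain ⟨t, ht, rfl⟩ := h
  by_cases hlt : cs.length (cs.simple i * v * t) < cs.length (cs.simple i * v)
  · exact Or.inl ⟨t, ⟨ht.1, hlt⟩, by rw [mul_assoc]⟩
  · right
    obtain ⟨ω, hω, hv⟩ := cs.exists_isReduced (v * t)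
    have hgt : cs.IsRightInversion (cs.simple i * v * t) t := by
      rw [ht.1.isRightInversion_mul_left_iff]
      exact fun h => hlt h.2
    have hword : cs.simple i * v * t = cs.wordProd (i :: ω) := by
      rw [wordProd_cons, ← hv, mul_assoc]
    rw [hword] at hgt
    have hmem := hgt.mem_rightInvSeq
    rw [rightInvSeq, List.mem_cons] at hmem
    rcases hmem with h | h
    · rw [← hv] at h
      have h1 : v * t * t = cs.simple i * (v * t) := by
        nth_rewrite 2 [h]
        group
      rw [← h1, mul_assoc, ht.1.mul_self, mul_one]
    · have h1 := (cs.isRightInversion_of_mem_rightInvSeq hω h).2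
      rw [← hv, mul_assoc, ht.1.mul_self, mul_one] at h1
      exact absurd ht.2 h1.not_gt

open Relation in
theorem reflTransGen_reflectionStep_simple_mul {x v : W}
    (h : ReflTransGen cs.ReflectionStep x v) (i : B) :
    ReflTransGen cs.ReflectionStep (cs.simple i * x) (cs.simple i * v) ∨
      ReflTransGen cs.ReflectionStep (cs.simple i * x) v := by
  induction h with
  | refl => exact Or.inl .refl
  | tail _ hstep ih =>
    rcases ih with ih | ih
    · rcases hstep.simple_mul cs i with h | h
      · exact Or.inl (ih.tail h)
      · exact Or.inr (h ▸ ih)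
    · exact Or.inr (ih.tail hstep)

theorem IsReduced.reflectionStep_cons {i : B} {ω : List B} (h : cs.IsReduced (i :: ω)) :
    cs.ReflectionStep (cs.wordProd ω) (cs.wordProd (i :: ω)) := by
  have hmem : (cs.wordProd ω)⁻¹ * cs.simple i * cs.wordProd ω ∈ cs.rightInvSeq (i :: ω) := by
    simp [rightInvSeq]
  refine ⟨_, cs.isRightInversion_of_mem_rightInvSeq h hmem, ?_⟩
  rw [wordProd_cons]
  simp [mul_assoc]

-- Going through the letters of `ω`, a dropped letter costs one reflection step, and a kept letter
-- is handled by the lifting property just proved.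
open Relation in
theorem reflTransGen_reflectionStep_of_sublist {ω ω' : List B} (hω : cs.IsReduced ω)
    (h : ω'.Sublist ω) :
    ReflTransGen cs.ReflectionStep (cs.wordProd ω') (cs.wordProd ω) := by
  induction h with
  | slnil => exact .refl
  | cons i _ ih => exact (ih (by simpa using hω.drop 1)).tail hω.reflectionStep_cons
  | cons_cons i _ ih =>
    rcases cs.reflTransGen_reflectionStep_simple_mul (ih (by simpa using hω.drop 1)) i with h | h
    · simpa only [wordProd_cons] using h
    · rw [wordProd_cons _ i]
      exact h.tail hω.reflectionStep_cons

/-- The preorder on `W` that compares the minimal lengths in the cosets `x H` and `v H`. -/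
def CosetLE (H : Subgroup W) (x v : W) : Prop :=
  x⁻¹ * v ∈ H ∨ ∃ h ∈ H, ∀ k ∈ H, cs.length (x * h) < cs.length (v * k)

variable {cs} {H : Subgroup W} {x y z : W}

theorem CosetLE.of_mem (h : x⁻¹ * y ∈ H) : cs.CosetLE H x y := Or.inl h

theorem CosetLE.trans (h : cs.CosetLE H x y) (h' : cs.CosetLE H y z) : cs.CosetLE H x z := by
  rcases h with h | ⟨a, ha, h⟩
  · rcases h' with h' | ⟨b, hb, h'⟩
    · left
      simpa [mul_assoc] using H.mul_mem h h'
    · refine Or.inr ⟨x⁻¹ * y * b, H.mul_mem h hb, fun k hk => ?_⟩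
      simpa [mul_assoc] using h' k hk
  · refine Or.inr ⟨a, ha, fun k hk => ?_⟩
    rcases h' with h' | ⟨b, hb, h'⟩
    · simpa [mul_assoc] using h (y⁻¹ * z * k) (H.mul_mem h' hk)
    · exact (h b hb).trans (h' k hk)

/-- Two opposite strict inequalities are impossible. This is why distinct cosets of equal minimal
length are left incomparable. -/
theorem CosetLE.mem_of_symm (h : cs.CosetLE H x y) (h' : cs.CosetLE H y x) : x⁻¹ * y ∈ H := by
  rcases h with h | ⟨a, ha, h⟩
  · exact h
  · rcases h' with h' | ⟨b, hb, h'⟩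
    · simpa using H.inv_mem h'
    · exact absurd (h b hb) (h' a ha).not_gt

theorem exists_wordProd_of_mem_closure {J : Set B} {w : W}
    (hw : w ∈ Subgroup.closure (cs.simple '' J)) :
    ∃ ω : List B, (∀ i ∈ ω, i ∈ J) ∧ w = cs.wordProd ω := by
  induction hw using Subgroup.closure_induction with
  | mem w hw =>
    obtain ⟨i, hi, rfl⟩ := hw
    exact ⟨[i], by simpa using hi, by simp⟩
  | one => exact ⟨[], by simp, by simp⟩
  | mul _ _ _ _ h h' =>
    obtain ⟨ω, hω, rfl⟩ := h
    obtain ⟨ω', hω', rfl⟩ := h'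
    exact ⟨ω ++ ω', fun i hi => (List.mem_append.1 hi).elim (hω i) (hω' i),
      (cs.wordProd_append _ _).symm⟩
  | inv _ _ h =>
    obtain ⟨ω, hω, rfl⟩ := h
    exact ⟨ω.reverse, by simpa using hω, by simp⟩

theorem wordProd_mem_closure {J : Set B} {ω : List B} (hω : ∀ i ∈ ω, i ∈ J) :
    cs.wordProd ω ∈ Subgroup.closure (cs.simple '' J) := by
  induction ω with
  | nil => simp
  | cons i ω ih =>
    rw [wordProd_cons]
    simp only [List.mem_cons, forall_eq_or_imp] at hω
    exact Subgroup.mul_mem _ (Subgroup.subset_closure ⟨i, hω.1, rfl⟩) (ih hω.2)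

theorem ReflectionStep.cosetLE {v : W} (hstep : cs.ReflectionStep x v) (J : Set B) :
    cs.CosetLE (Subgroup.closure (cs.simple '' J)) x v := by
  set H := Subgroup.closure (cs.simple '' J)
  obtain ⟨t, ht, rfl⟩ := hstep
  -- Here `v h` is a shortest element of `v H`. A reduced word `ω` of it, followed by a word `η` in
  -- `J` for `h⁻¹`, spells `v`; this word may be non-reduced, which strong exchange allows.
  obtain ⟨⟨h, hh⟩, -, hmin⟩ := (measure fun h : H => cs.length (v * h)).wf.has_min
    Set.univ ⟨1, trivial⟩
  obtain ⟨ω, hω, hc⟩ := cs.exists_isReduced (v * h)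
  obtain ⟨η, hη, hh'⟩ := exists_wordProd_of_mem_closure (H.inv_mem hh)
  have hv : v = cs.wordProd (ω ++ η) := by rw [wordProd_append, ← hc, ← hh', mul_inv_cancel_right]
  have hex := (hv ▸ ht).exists_eraseIdx
  rw [← hv] at hex
  obtain ⟨j, -, hj⟩ := hex
  rw [hj]
  -- Deleting a letter of `ω` produces a coset with smaller minimal length; deleting one of `η`
  -- stays in `v H`.
  rcases lt_or_ge j ω.length with hlt | hge
  · rw [List.eraseIdx_append_of_lt_length hlt, wordProd_append, ← hh']
    refine Or.inr ⟨h, hh, fun k hk => ?_⟩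
    calc cs.length (cs.wordProd (ω.eraseIdx j) * h⁻¹ * h)
        ≤ (ω.eraseIdx j).length := by
          rw [inv_mul_cancel_right]; exact cs.length_wordProd_le _
      _ < ω.length := by rw [← List.length_eraseIdx_add_one hlt]; exact Nat.lt_succ_self _
      _ = cs.length (v * h) := by rw [hc, hω.eq]
      _ ≤ cs.length (v * k) := not_lt.1 (hmin ⟨k, hk⟩ trivial)
  · rw [List.eraseIdx_append_of_length_le hge, wordProd_append, ← hc]
    refine .of_mem ?_
    have hmem : cs.wordProd (η.eraseIdx (j - ω.length)) ∈ H :=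
      wordProd_mem_closure fun i hi => hη i (List.mem_of_mem_eraseIdx hi)
    simpa [mul_assoc] using H.mul_mem (H.inv_mem hmem) (H.inv_mem hh)

open Relation in
theorem cosetLE_of_reflTransGen {v : W} (h : ReflTransGen cs.ReflectionStep x v) (J : Set B) :
    cs.CosetLE (Subgroup.closure (cs.simple '' J)) x v := by
  induction h with
  | refl => exact .of_mem (by simp)
  | tail _ hstep ih => exact ih.trans (hstep.cosetLE J)

theorem cosetLE_of_sublist {ω ω' : List B} (hω : cs.IsReduced ω) (h : ω'.Sublist ω) (J : Set B) :
    cs.CosetLE (Subgroup.closure (cs.simple '' J)) (cs.wordProd ω') (cs.wordProd ω) :=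
  cosetLE_of_reflTransGen (cs.reflTransGen_reflectionStep_of_sublist hω h) J

end Bruhat

end CoxeterSystem

namespace RennerCoxeter

/-! ### Transfer to the Bruhat order defined by words in `S`. -/

section BruhatWords

variable {W : Type*} [Group W] {S : Set W} {M : CoxeterMatrix S} {cs : CoxeterSystem M W}

theorem wordProd_eq_prod_map_coe (hcs : ∀ s : S, cs.simple s = (s : W)) (ω : List S) :
    cs.wordProd ω = (ω.map (↑)).prod := by
  rw [CoxeterSystem.wordProd]
  congr 1
  exact List.map_congr_left fun s _ => hcs s

theorem IsReducedWord.isReduced (hcs : ∀ s : S, cs.simple s = (s : W)) {ω : List S} {w : W}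
    (h : IsReducedWord S (ω.map (↑)) w) : cs.IsReduced ω := by
  obtain ⟨-, hprod, hmin⟩ := h
  refine (cs.length_wordProd_le ω).antisymm ?_
  obtain ⟨ω', hω', hω''⟩ := cs.exists_isReduced (cs.wordProd ω)
  rw [hω'', hω'.eq]
  rw [wordProd_eq_prod_map_coe hcs, wordProd_eq_prod_map_coe hcs, hprod] at hω''
  simpa using hmin (ω'.map (↑)) (by simp +contextual) hω''.symm

theorem BruhatLE.exists_sublist (hcs : ∀ s : S, cs.simple s = (s : W)) {u v : W}
    (h : BruhatLE S u v) : ∃ ω ω' : List S, cs.IsReduced ω ∧ ω'.Sublist ω ∧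
      v = cs.wordProd ω ∧ u = cs.wordProd ω' := by
  obtain ⟨l, l', hl, hl', hsub⟩ := h
  obtain ⟨hS, hprod, -⟩ := id hl
  lift l to List S using hS
  obtain ⟨ω', hω', rfl⟩ := List.sublist_map_iff.1 hsub
  exact ⟨l, ω', hl.isReduced hcs, hω', by rw [wordProd_eq_prod_map_coe hcs, hprod],
    by rw [wordProd_eq_prod_map_coe hcs, hl'.2.1]⟩

theorem closure_simple_image (hcs : ∀ s : S, cs.simple s = (s : W)) {I : Set W} (hI : I ⊆ S) :
    Subgroup.closure (cs.simple '' {s | (s : W) ∈ I}) = parabolic I := by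
  rw [parabolic]
  congr 1
  ext w
  constructor
  · rintro ⟨s, hs, rfl⟩
    rw [hcs]
    exact hs
  · exact fun hw => ⟨⟨w, hI hw⟩, hw, hcs _⟩

theorem BruhatLE.cosetLE (hcs : ∀ s : S, cs.simple s = (s : W)) {I : Set W} (hI : I ⊆ S)
    {u v : W} (h : BruhatLE S u v) : cs.CosetLE (parabolic I) u v := by
  obtain ⟨ω, ω', hω, hsub, rfl, rfl⟩ := h.exists_sublist hcs
  rw [← closure_simple_image hcs hI]
  exact CoxeterSystem.cosetLE_of_sublist hω hsub _

/-- Reversing words respects reducedness and subwords. Inversion lets `CosetLE`, which concerns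
cosets `u H`, also handle the cosets `H u`. -/
theorem BruhatLE.cosetLE_inv (hcs : ∀ s : S, cs.simple s = (s : W)) {I : Set W} (hI : I ⊆ S)
    {u v : W} (h : BruhatLE S u v) : cs.CosetLE (parabolic I) u⁻¹ v⁻¹ := by
  obtain ⟨ω, ω', hω, hsub, rfl, rfl⟩ := h.exists_sublist hcs
  rw [← closure_simple_image hcs hI, ← cs.wordProd_reverse, ← cs.wordProd_reverse]
  exact CoxeterSystem.cosetLE_of_sublist hω.reverse hsub.reverse _

end BruhatWords

/-! ### Green's relations and factorizable monoids. -/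

section Green

variable {R : Type*} [Monoid R] {r s : R}

theorem IdemLE.trans {e f g : R} (h : IdemLE e f) (h' : IdemLE f g) : IdemLE e g :=
  ⟨by rw [← h.1, mul_assoc, h'.1], by rw [← h.2, ← mul_assoc, h'.2]⟩

theorem IdemLE.antisymm {e f : R} (h : IdemLE e f) (h' : IdemLE f e) : e = f := by
  rw [← h.1, h'.2]

theorem IdemLE.conj {e f : R} (h : IdemLE e f) (w : Rˣ) :
    IdemLE (w * e * (w⁻¹ : Rˣ)) (w * f * (w⁻¹ : Rˣ)) := by
  constructor
  · simp only [mul_assoc, Units.inv_mul_cancel_left]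
    rw [← mul_assoc e, h.1]
  · simp only [mul_assoc, Units.inv_mul_cancel_left]
    rw [← mul_assoc f, h.2]

theorem isIdempotentElem_conj {e : R} (he : IsIdempotentElem e) (w : Rˣ) :
    IsIdempotentElem (w * e * (w⁻¹ : Rˣ)) := by
  rw [IsIdempotentElem]
  simp only [mul_assoc, Units.inv_mul_cancel_left]
  rw [← mul_assoc e, he.eq]

theorem greenJ_iff : GreenJ r s ↔ (∃ p q, r = p * s * q) ∧ ∃ p q, s = p * r * q := by
  constructor
  · intro h
    exact ⟨(Set.ext_iff.1 h r).1 ⟨1, 1, by simp⟩, (Set.ext_iff.1 h s).2 ⟨1, 1, by simp⟩⟩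
  · rintro ⟨⟨p, q, h⟩, p', q', h'⟩
    ext t
    constructor
    · rintro ⟨a, b, rfl⟩
      exact ⟨a * p, q * b, by rw [h]; simp only [mul_assoc]⟩
    · rintro ⟨a, b, rfl⟩
      exact ⟨a * p', q' * b, by rw [h']; simp only [mul_assoc]⟩

theorem greenL_iff : GreenL r s ↔ (∃ p, r = p * s) ∧ ∃ p, s = p * r := by
  constructor
  · intro h
    exact ⟨(Set.ext_iff.1 h r).1 ⟨1, by simp⟩, (Set.ext_iff.1 h s).2 ⟨1, by simp⟩⟩
  · rintro ⟨⟨p, h⟩, p', h'⟩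
    ext t
    constructor
    · rintro ⟨a, rfl⟩
      exact ⟨a * p, by rw [h, mul_assoc]⟩
    · rintro ⟨a, rfl⟩
      exact ⟨a * p', by rw [h', mul_assoc]⟩

theorem greenR_iff : GreenR r s ↔ (∃ q, r = s * q) ∧ ∃ q, s = r * q := by
  constructor
  · intro h
    exact ⟨(Set.ext_iff.1 h r).1 ⟨1, by simp⟩, (Set.ext_iff.1 h s).2 ⟨1, by simp⟩⟩
  · rintro ⟨⟨q, h⟩, q', h'⟩
    ext t
    constructor
    · rintro ⟨a, rfl⟩
      exact ⟨q * a, by rw [h, mul_assoc]⟩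
    · rintro ⟨a, rfl⟩
      exact ⟨q' * a, by rw [h', mul_assoc]⟩

theorem GreenL.greenJ (h : GreenL r s) : GreenJ r s := by
  obtain ⟨⟨p, hp⟩, p', hp'⟩ := greenL_iff.1 h
  exact greenJ_iff.2 ⟨⟨p, 1, by rw [mul_one, hp]⟩, p', 1, by rw [mul_one, hp']⟩

theorem GreenR.greenJ (h : GreenR r s) : GreenJ r s := by
  obtain ⟨⟨p, hp⟩, p', hp'⟩ := greenR_iff.1 h
  exact greenJ_iff.2 ⟨⟨1, p, by rw [one_mul, hp]⟩, 1, p', by rw [one_mul, hp']⟩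

theorem greenJ_unit_mul_mul_unit (e : R) (x y a b : Rˣ) : GreenJ (x * e * y) (a * e * b : R) :=
  greenJ_iff.2 ⟨⟨x * (a⁻¹ : Rˣ), (b⁻¹ : Rˣ) * y, by simp [mul_assoc]⟩,
    a * (x⁻¹ : Rˣ), (y⁻¹ : Rˣ) * b, by simp [mul_assoc]⟩

theorem greenR_of_commute {e : R} {x a : Rˣ} (y b : Rˣ)
    (h : ((x⁻¹ * a : Rˣ) : R) * e = e * (x⁻¹ * a : Rˣ)) : GreenR (x * e * y) (a * e * b : R) := by
  have hae : (a : R) * e = x * e * (x⁻¹ * a : Rˣ) := by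
    rw [mul_assoc, ← h]
    simp [mul_assoc]
  rw [hae]
  exact greenR_iff.2 ⟨⟨((x⁻¹ * a * b)⁻¹ * y : Rˣ), by simp [mul_assoc]⟩,
    (y⁻¹ * (x⁻¹ * a * b) : Rˣ), by simp [mul_assoc]⟩

theorem greenL_of_commute {e : R} {y b : Rˣ} (x a : Rˣ)
    (h : ((b * y⁻¹ : Rˣ) : R) * e = e * (b * y⁻¹ : Rˣ)) : GreenL (x * e * y) (a * e * b : R) := by
  have heb : e * (b : R) = (b * y⁻¹ : Rˣ) * (e * y) := by
    rw [← mul_assoc, h]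
    simp [mul_assoc]
  rw [mul_assoc, mul_assoc (a : R), heb]
  exact greenL_iff.2 ⟨⟨(x * (a * (b * y⁻¹))⁻¹ : Rˣ), by simp [mul_assoc]⟩,
    (a * (b * y⁻¹) * x⁻¹ : Rˣ), by simp [mul_assoc]⟩

namespace IsFactorizable

variable (hR : IsFactorizable R)
include hR

/-- The hypotheses say that `e` and `g e g⁻¹` generate the same right ideal; commuting idempotents
with this property are equal. -/
theorem commute_of_eq {e : R} (he : IsIdempotentElem e) {g : Rˣ} {p p' : R}
    (h : e = g * e * p) (h' : (g : R) * e = e * p') : (g : R) * e = e * g := by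
  have h1 : (g * e * (g⁻¹ : Rˣ) : R) * e = e := by
    nth_rewrite 2 [h]
    simp only [mul_assoc, Units.inv_mul_cancel_left]
    rw [← mul_assoc e, he.eq, ← mul_assoc, ← h]
  have h2 : e * (g * e * (g⁻¹ : Rˣ) : R) = g * e * (g⁻¹ : Rˣ) := by
    rw [h', ← mul_assoc, ← mul_assoc, he.eq]
  rw [hR.idem_comm _ _ he (isIdempotentElem_conj he g), h1] at h2
  nth_rewrite 2 [h2]
  simp [mul_assoc]

theorem commute_of_greenR {e : R} (he : IsIdempotentElem e) {x y a b : Rˣ}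
    (h : GreenR (x * e * y) (a * e * b : R)) :
    ((x⁻¹ * a : Rˣ) : R) * e = e * (x⁻¹ * a : Rˣ) := by
  obtain ⟨⟨q, hq⟩, q', hq'⟩ := greenR_iff.1 h
  refine hR.commute_of_eq he (p := b * q * (y⁻¹ : Rˣ)) (p' := y * q' * (b⁻¹ : Rˣ)) ?_ ?_
  · have := congrArg (fun t : R => (x⁻¹ : Rˣ) * t * (y⁻¹ : Rˣ)) hq
    simpa [mul_assoc] using this
  · have := congrArg (fun t : R => (x⁻¹ : Rˣ) * t * (b⁻¹ : Rˣ)) hq'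
    simpa [mul_assoc] using this

theorem commute_of_greenL {e : R} (he : IsIdempotentElem e) {x y a b : Rˣ}
    (h : GreenL (x * e * y) (a * e * b : R)) :
    ((b * y⁻¹ : Rˣ) : R) * e = e * (b * y⁻¹ : Rˣ) := by
  obtain ⟨⟨q, hq⟩, q', hq'⟩ := greenL_iff.1 h
  set g : Rˣ := b * y⁻¹ with hg
  have h1 : e = ((x⁻¹ : Rˣ) * q * a) * (e * g) := by
    have := congrArg (fun t : R => (x⁻¹ : Rˣ) * t * (y⁻¹ : Rˣ)) hq
    simpa [hg, mul_assoc] using this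
  have h2 : e * g = ((a⁻¹ : Rˣ) * q' * x) * e := by
    have := congrArg (fun t : R => (a⁻¹ : Rˣ) * t * (y⁻¹ : Rˣ)) hq'
    simpa [hg, mul_assoc] using this
  -- Mirror argument: `e` and `g⁻¹ e g` generate the same left ideal, hence coincide.
  have h3 : e * ((g⁻¹ : Rˣ) * e * g) = e := by
    nth_rewrite 1 [h1]
    simp only [mul_assoc, Units.mul_inv_cancel_left]
    rw [← mul_assoc e e, he.eq]
    simpa only [mul_assoc] using h1.symm
  have h4 : ((g⁻¹ : Rˣ) * e * g) * e = (g⁻¹ : Rˣ) * e * g := by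
    rw [mul_assoc _ e, h2]
    simp only [mul_assoc, he.eq]
  have hidem := isIdempotentElem_conj he g⁻¹
  rw [inv_inv] at hidem
  rw [hR.idem_comm _ _ hidem he, h3] at h4
  nth_rewrite 1 [h4]
  simp [mul_assoc]

/-- If `f ∈ R e R` for idempotents `e` and `f`, then `f` lies below a conjugate of `e`. -/
theorem exists_idemLE_conj {e f p q : R} (he : IsIdempotentElem e) (hf : IsIdempotentElem f)
    (h : f = p * e * q) : ∃ u : Rˣ, IdemLE f (u * e * (u⁻¹ : Rˣ)) := by
  obtain ⟨g, u, hg, rfl⟩ := hR.idem_mul_unit p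
  obtain ⟨v, k, hk, rfl⟩ := hR.unit_mul_idem q
  refine ⟨u, ?_⟩
  set c : R := u * e * (u⁻¹ : Rˣ) with hc
  set d : R := (u * v : Rˣ) * k * ((u * v)⁻¹ : Rˣ) with hd
  have hci : IsIdempotentElem c := isIdempotentElem_conj he u
  have hdi : IsIdempotentElem d := isIdempotentElem_conj hk (u * v)
  have hcd := hR.idem_comm c d hci hdi
  have hgd := hR.idem_comm g d hg hdi
  have hgc := hR.idem_comm g c hg hci
  have hcd' : IsIdempotentElem (c * d) := hci.mul_of_commute hcd hdi
  have hi : IsIdempotentElem (g * (c * d)) :=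
    hg.mul_of_commute (Commute.mul_right hgc hgd) hcd'
  set i := g * (c * d) with hidef
  -- Moving the units to the right leaves the idempotent `i = g c d`. Then `f` and `i` generate the
  -- same right ideal, so `f = i ≤ c`.
  have hfi : f = i * (u * v : Rˣ) := by
    rw [h, hidef, hc, hd]
    simp [mul_assoc]
  have h1 : i * f = f := by rw [hfi, ← mul_assoc, hi.eq]
  have h2 : f * i = i := by
    have : i = f * ((u * v)⁻¹ : Rˣ) := by rw [hfi, mul_assoc, Units.mul_inv, mul_one]
    rw [this, ← mul_assoc, hf.eq]
  have hfi' : f = i := by rw [← h1, hR.idem_comm i f hi hf, h2]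
  have h3 : f * c = f := by
    rw [hfi', hidef, hcd, mul_assoc, mul_assoc, hci.eq]
  exact ⟨h3, by rw [← hR.idem_comm f c hf hci, h3]⟩

end IsFactorizable

/-- Iterating the conjugation gives `f ≤ wⁿ f w⁻ⁿ` for all `n`. As `w` has finite order, some `wⁿ`
is `w⁻¹`, which yields the reverse inequality. -/
theorem eq_conj_of_idemLE_conj [Finite R] {f : R} {w : Rˣ}
    (h : IdemLE f (w * f * (w⁻¹ : Rˣ))) (hf : IsIdempotentElem f) : f = w * f * (w⁻¹ : Rˣ) := by
  have hpow : ∀ n : ℕ, IdemLE f ((w ^ n : Rˣ) * f * ((w ^ n)⁻¹ : Rˣ)) := by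
    intro n
    induction n with
    | zero => simpa [IdemLE] using hf.eq
    | succ n ih =>
      have := h.trans (ih.conj w)
      rw [pow_succ']
      simpa [mul_assoc] using this
  obtain ⟨n, hn⟩ : ∃ n : ℕ, w ^ n = w⁻¹ := by
    refine ⟨orderOf w - 1, ?_⟩
    rw [eq_inv_iff_mul_eq_one, ← pow_succ, Nat.sub_add_cancel (orderOf_pos w), pow_orderOf_eq_one]
  refine h.antisymm ?_
  have := (hn ▸ hpow n).conj w
  simpa [mul_assoc] using this

namespace IsRennerCoxeterSystem

variable {Λ : Set R} {S : Set Rˣ} (hR : IsRennerCoxeterSystem Λ S)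
include hR

/-- Each of `e`, `f` lies below a conjugate of the other, so by finiteness they are conjugate, hence
equal in the transversal. -/
theorem eq_of_greenJ [Finite R] {e f : R} (he : e ∈ Λ) (hf : f ∈ Λ) {x y a b : Rˣ}
    (h : GreenJ (x * e * y) (a * f * b : R)) : e = f := by
  have hei := hR.idem_of_mem e he
  have hfi := hR.idem_of_mem f hf
  obtain ⟨⟨p, q, hpq⟩, p', q', hpq'⟩ := greenJ_iff.1 h
  have h1 : f = (a⁻¹ : Rˣ) * p' * x * e * (y * q' * (b⁻¹ : Rˣ)) := by
    have := congrArg (fun t : R => (a⁻¹ : Rˣ) * t * (b⁻¹ : Rˣ)) hpq'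
    simpa [mul_assoc] using this
  have h2 : e = (x⁻¹ : Rˣ) * p * a * f * (b * q * (y⁻¹ : Rˣ)) := by
    have := congrArg (fun t : R => (x⁻¹ : Rˣ) * t * (y⁻¹ : Rˣ)) hpq
    simpa [mul_assoc] using this
  obtain ⟨u, hu⟩ := hR.factorizable.exists_idemLE_conj hei hfi h1
  obtain ⟨v, hv⟩ := hR.factorizable.exists_idemLE_conj hfi hei h2
  have h3 : IdemLE (u * e * (u⁻¹ : Rˣ)) ((u * v : Rˣ) * f * ((u * v)⁻¹ : Rˣ)) := by
    simpa [mul_assoc] using hv.conj u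
  have h4 := eq_conj_of_idemLE_conj (hu.trans h3) hfi
  rw [← h4] at h3
  exact (hR.transversal e hei).unique ⟨he, 1, by simp⟩ ⟨hf, u, h3.antisymm hu⟩

theorem exists_form (r : R) : ∃ x : Rˣ, ∃ e ∈ Λ, ∃ y : Rˣ, r = x * e * y := by
  obtain ⟨g, w, hg, rfl⟩ := hR.factorizable.idem_mul_unit r
  obtain ⟨f, ⟨hf, u, hu⟩, -⟩ := hR.transversal g hg
  exact ⟨u⁻¹, f, hf, u * w, by rw [← hu]; simp [mul_assoc]⟩

end IsRennerCoxeterSystem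

/-! ### The lexicographic relation and chains. -/

/-- The lexicographic relation on `R` given by the order on `Λ` and a family of relations `D e`
on the pairs of units `(x, y)` that represent the elements `x e y`. -/
def LexRel (Λ : Set R) (D : R → Rˣ → Rˣ → Rˣ → Rˣ → Prop) (r s : R) : Prop :=
  ∃ (x : Rˣ) (e : R) (y a : Rˣ) (f : R) (b : Rˣ), e ∈ Λ ∧ f ∈ Λ ∧ r = x * e * y ∧ s = a * f * b ∧
    IdemLE e f ∧ (e = f → D e x y a b)

theorem IsRennerCoxeterSystem.lexRel_trans [Finite R] {Λ : Set R} {S : Set Rˣ}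
    (hR : IsRennerCoxeterSystem Λ S) {D : R → Rˣ → Rˣ → Rˣ → Rˣ → Prop}
    (hD : ∀ e ∈ Λ, ∀ x y a b : Rˣ, (x * e * y : R) = a * e * b → D e x y a b)
    (hD' : ∀ (e : R) (x y a b c d : Rˣ), D e x y a b → D e a b c d → D e x y c d) {r s t : R}
    (h : LexRel Λ D r s) (h' : LexRel Λ D s t) : LexRel Λ D r t := by
  obtain ⟨x, e, y, a, f, b, he, hf, rfl, rfl, hef, h⟩ := h
  obtain ⟨a', f', b', c, g, d, hf', hg, heq, rfl, hfg, h'⟩ := h'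
  -- The middle element comes with two expressions. Their idempotents agree, and `hD` bridges their
  -- units.
  obtain rfl : f = f' := hR.eq_of_greenJ hf hf' (x := a) (y := b) (a := a') (b := b') (by
    rw [heq]; rfl)
  refine ⟨x, e, y, c, g, d, he, hg, rfl, rfl, hef.trans hfg, ?_⟩
  rintro rfl
  obtain rfl := hef.antisymm hfg
  exact hD' _ _ _ _ _ _ _ (hD' _ _ _ _ _ _ _ (h rfl) (hD _ he _ _ _ _ heq)) (h' rfl)

theorem IsRennerCoxeterSystem.green_of_lexRel [Finite R] {Λ : Set R} {S : Set Rˣ}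
    (hR : IsRennerCoxeterSystem Λ S) {D : R → Rˣ → Rˣ → Rˣ → Rˣ → Prop}
    (hD : ∀ e ∈ Λ, ∀ x y a b : Rˣ, (x * e * y : R) = a * e * b → D e x y a b)
    (hD' : ∀ (e : R) (x y a b c d : Rˣ), D e x y a b → D e a b c d → D e x y c d)
    {T : R → R → Prop} (hT : ∀ e ∈ Λ, ∀ x y a b : Rˣ, D e x y a b → D e a b x y →
      T (x * e * y) (a * e * b)) {r s : R}
    (h : LexRel Λ D r s) (h' : LexRel Λ D s r) : T r s := by
  obtain ⟨x, e, y, a, f, b, he, hf, rfl, rfl, hef, h⟩ := h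
  obtain ⟨a', f', b', x', e', y', hf', he', heq, heq', hfe, h'⟩ := h'
  obtain rfl : f = f' := hR.eq_of_greenJ hf hf' (x := a) (y := b) (a := a') (b := b') (by
    rw [heq]; rfl)
  obtain rfl : e = e' := hR.eq_of_greenJ he he' (x := x) (y := y) (a := x') (b := y') (by
    rw [heq']; rfl)
  obtain rfl := hef.antisymm hfe
  exact hT e he _ _ _ _ (h rfl) (hD' _ _ _ _ _ _ _ (hD _ he _ _ _ _ heq)
    (hD' _ _ _ _ _ _ _ (h' rfl) (hD _ he _ _ _ _ heq'.symm)))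

/-- The relation `T` between the ends gives `LexRel` from `r n` back to `r 0`, closing the chain
into a cycle; so `r 0` and `r i` are related both ways. -/
theorem IsRennerCoxeterSystem.green_chain [Finite R] {Λ : Set R} {S : Set Rˣ}
    (hR : IsRennerCoxeterSystem Λ S) {le : R → R → Prop} {D : R → Rˣ → Rˣ → Rˣ → Rˣ → Prop}
    (hle : ∀ r s, le r s → LexRel Λ D r s)
    (hD' : ∀ (e : R) (x y a b c d : Rˣ), D e x y a b → D e a b c d → D e x y c d)
    {T : R → R → Prop} (hT : ∀ e ∈ Λ, ∀ x y a b : Rˣ, D e x y a b → D e a b x y →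
      T (x * e * y) (a * e * b))
    (hTJ : ∀ r s, T r s → GreenJ r s) (hrefl : ∀ r, T r r)
    (hTD : ∀ e ∈ Λ, ∀ x y a b : Rˣ, T (x * e * y) (a * e * b) → D e a b x y)
    {n : ℕ} {r : Fin (n + 1) → R} (hchain : ∀ i : Fin n, le (r i.castSucc) (r i.succ))
    (hends : T (r 0) (r (Fin.last n))) (i : Fin (n + 1)) : T (r 0) (r i) := by
  -- Two expressions of one element are `T`-related by reflexivity.
  have hD : ∀ e ∈ Λ, ∀ x y a b : Rˣ, (x * e * y : R) = a * e * b → D e x y a b :=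
    fun e he x y a b h => hTD e he a b x y (h ▸ hrefl _)
  have htrans : IsTrans R (LexRel Λ D) := ⟨fun _ _ _ => hR.lexRel_trans hD hD'⟩
  have hlt := (Fin.liftFun_iff_succ (LexRel Λ D) (f := r)).2 fun i => hle _ _ (hchain i)
  have hback : LexRel Λ D (r (Fin.last n)) (r 0) := by
    obtain ⟨x, e, y, a, f, b, he, hf, hr, hs⟩ : ∃ (x : Rˣ) (e : R) (y a : Rˣ) (f : R) (b : Rˣ),
        e ∈ Λ ∧ f ∈ Λ ∧ r 0 = x * e * y ∧ r (Fin.last n) = a * f * b := by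
      obtain ⟨x, e, he, y, hr⟩ := hR.exists_form (r 0)
      obtain ⟨a, f, hf, b, hs⟩ := hR.exists_form (r (Fin.last n))
      exact ⟨x, e, y, a, f, b, he, hf, hr, hs⟩
    rw [hr, hs] at hends
    obtain rfl := hR.eq_of_greenJ he hf (hTJ _ _ hends)
    have hei := hR.idem_of_mem e he
    exact ⟨a, e, b, x, e, y, he, he, hs, hr, ⟨hei, hei⟩, fun _ => hTD e he _ _ _ _ hends⟩
  rcases eq_or_ne i 0 with rfl | hi
  · exact hrefl _
  · have h0 : LexRel Λ D (r 0) (r i) := hlt (Fin.pos_iff_ne_zero.2 hi)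
    refine hR.green_of_lexRel hD hD' hT h0 ?_
    rcases eq_or_ne i (Fin.last n) with rfl | hin
    · exact hback
    · exact htrans.trans _ _ _ (hlt (Fin.lt_last_iff_ne_last.2 hin)) hback

/-! ### Application to the two Adherence orders. -/

theorem lowerType_subset_typeMap (S : Set Rˣ) (e : R) : lowerType S e ⊆ typeMap S e :=
  fun _ h => ⟨h.1, h.2.1⟩

theorem upperType_subset_typeMap (S : Set Rˣ) (e : R) : upperType S e ⊆ typeMap S e :=
  fun _ h => ⟨h.1, h.2.1⟩

open CoxeterSystem in
theorem AdhPlus.lexRel {Λ : Set R} {S : Set Rˣ} {M : CoxeterMatrix S} {cs : CoxeterSystem M Rˣ}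
    (hcs : ∀ s : S, cs.simple s = (s : Rˣ)) {r s : R} (h : AdhPlus Λ S r s) :
    LexRel Λ (fun e x y a b => cs.CosetLE (parabolic (typeMap S e)) x a ∧
      cs.CosetLE (parabolic (typeMap S e)) b⁻¹ y⁻¹) r s := by
  obtain ⟨x, e, y, a, f, b, hr, hs, hef, u, hu, v, hv, hx, hy⟩ := h
  refine ⟨x, e, y, a, f, b, hr.2.1, hs.2.1, hr.1, hs.1, hef, ?_⟩
  rintro rfl
  -- Once `e = f`, both factors of `w = u v` commute with `e`, so `w` disappears modulo `W_{λ(e)}`.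
  have hw : u * v ∈ parabolic (typeMap S e) :=
    Subgroup.mul_mem _ (Subgroup.closure_mono (upperType_subset_typeMap S e) hu)
      (Subgroup.closure_mono (lowerType_subset_typeMap S e) hv)
  have hS : typeMap S e ⊆ S := fun _ h => h.1
  exact ⟨(hx.cosetLE hcs hS).trans (.of_mem (by simpa [mul_assoc] using Subgroup.inv_mem _ hw)),
    CosetLE.trans (.of_mem (by simpa [mul_assoc] using hw)) (hy.cosetLE_inv hcs hS)⟩

open CoxeterSystem in
theorem AdhMinus.lexRel {Λ : Set R} {S : Set Rˣ} {M : CoxeterMatrix S} {cs : CoxeterSystem M Rˣ}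
    (hcs : ∀ s : S, cs.simple s = (s : Rˣ)) {r s : R} (h : AdhMinus Λ S r s) :
    LexRel Λ (fun e x y a b => cs.CosetLE (parabolic (typeMap S e)) a x ∧
      cs.CosetLE (parabolic (typeMap S e)) y⁻¹ b⁻¹) r s := by
  obtain ⟨y, e, x, b, f, a, hr, hs, hef, u, hu, v, hv, hx, hy⟩ := h
  refine ⟨y, e, x, b, f, a, hr.2.1, hs.2.1, hr.1, hs.1, hef, ?_⟩
  rintro rfl
  have hw : u * v ∈ parabolic (typeMap S e) :=
    Subgroup.mul_mem _ (Subgroup.closure_mono (lowerType_subset_typeMap S e) hu)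
      (Subgroup.closure_mono (upperType_subset_typeMap S e) hv)
  have hS : typeMap S e ⊆ S := fun _ h => h.1
  exact ⟨CosetLE.trans (.of_mem (by simpa [mul_assoc] using Subgroup.inv_mem _ hw))
      (hy.cosetLE hcs hS),
    (hx.cosetLE_inv hcs hS).trans (.of_mem (by simpa [mul_assoc] using hw))⟩

theorem LexRel.mono {Λ : Set R} {D D' : R → Rˣ → Rˣ → Rˣ → Rˣ → Prop}
    (hD : ∀ e x y a b, D e x y a b → D' e x y a b) {r s : R} (h : LexRel Λ D r s) :
    LexRel Λ D' r s := by
  obtain ⟨x, e, y, a, f, b, he, hf, hr, hs, hef, h⟩ := h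
  exact ⟨x, e, y, a, f, b, he, hf, hr, hs, hef, fun h' => hD _ _ _ _ _ (h h')⟩

namespace IsRennerCoxeterSystem

variable [Finite R] {Λ : Set R} {S : Set Rˣ} (hR : IsRennerCoxeterSystem Λ S)
  {le : R → R → Prop} {n : ℕ} {r : Fin (n + 1) → R}
include hR

theorem greenJ_chain (hle : ∀ r s, le r s → LexRel Λ (fun _ _ _ _ _ => True) r s)
    (hchain : ∀ i : Fin n, le (r i.castSucc) (r i.succ))
    (hends : GreenJ (r 0) (r (Fin.last n))) (i : Fin (n + 1)) : GreenJ (r 0) (r i) :=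
  hR.green_chain hle (fun _ _ _ _ _ _ _ _ _ => trivial)
    (fun e _ x y a b _ _ => greenJ_unit_mul_mul_unit e x y a b) (fun _ _ h => h) (fun _ => rfl)
    (fun _ _ _ _ _ _ _ => trivial) hchain hends i

/-- The relation `P` stands for `CosetLE` or its opposite, since `≤⁺` and `≤⁻` move the cosets `x
W_{λ(e)}` in opposite directions. -/
theorem greenR_chain {P : R → Rˣ → Rˣ → Prop} (hP : ∀ e x y z, P e x y → P e y z → P e x z)
    (hmem : ∀ e x y, x⁻¹ * y ∈ parabolic (typeMap S e) ↔ P e x y ∧ P e y x)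
    (hle : ∀ r s, le r s → LexRel Λ (fun e x _ a _ => P e x a) r s)
    (hchain : ∀ i : Fin n, le (r i.castSucc) (r i.succ))
    (hends : GreenR (r 0) (r (Fin.last n))) (i : Fin (n + 1)) : GreenR (r 0) (r i) :=
  hR.green_chain hle (fun e x _ a _ c _ => hP e x a c)
    (fun e he x y a b h h' => greenR_of_commute y b
      ((hR.mem_parabolic_typeMap he _).1 ((hmem e x a).2 ⟨h, h'⟩)))
    (fun _ _ h => h.greenJ) (fun _ => rfl)
    (fun e he x _ a _ h => ((hmem e x a).1 ((hR.mem_parabolic_typeMap he _).2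
      (hR.factorizable.commute_of_greenR (hR.idem_of_mem e he) h))).2) hchain hends i

theorem greenL_chain {P : R → Rˣ → Rˣ → Prop} (hP : ∀ e x y z, P e x y → P e y z → P e x z)
    (hmem : ∀ e x y, x⁻¹ * y ∈ parabolic (typeMap S e) ↔ P e x y ∧ P e y x)
    (hle : ∀ r s, le r s → LexRel Λ (fun e _ y _ b => P e y⁻¹ b⁻¹) r s)
    (hchain : ∀ i : Fin n, le (r i.castSucc) (r i.succ))
    (hends : GreenL (r 0) (r (Fin.last n))) (i : Fin (n + 1)) : GreenL (r 0) (r i) := by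
  refine hR.green_chain hle (fun e _ y _ b _ d => hP e y⁻¹ b⁻¹ d⁻¹)
    (fun e he x y a b h h' => greenL_of_commute x a
      ((hR.mem_parabolic_typeMap he _).1 ?_))
    (fun _ _ h => h.greenJ) (fun _ => rfl)
    (fun e he _ y _ b h => ((hmem e b⁻¹ y⁻¹).1 ?_).1) hchain hends i
  · simpa using (hmem e b⁻¹ y⁻¹).2 ⟨h', h⟩
  · simpa using (hR.mem_parabolic_typeMap he _).2
      (hR.factorizable.commute_of_greenL (hR.idem_of_mem e he) h)

open CoxeterSystem in
theorem green_chain_of_adherence (hle : le = AdhPlus Λ S ∨ le = AdhMinus Λ S)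
    (hchain : ∀ i : Fin n, le (r i.castSucc) (r i.succ)) (i : Fin (n + 1)) :
    (GreenJ (r 0) (r (Fin.last n)) → GreenJ (r 0) (r i)) ∧
    (GreenR (r 0) (r (Fin.last n)) → GreenR (r 0) (r i)) ∧
    (GreenL (r 0) (r (Fin.last n)) → GreenL (r 0) (r i)) := by
  obtain ⟨M, cs, hcs⟩ := hR.coxeter
  have hmem : ∀ (e : R) (x y : Rˣ), x⁻¹ * y ∈ parabolic (typeMap S e) ↔
      cs.CosetLE (parabolic (typeMap S e)) x y ∧ cs.CosetLE (parabolic (typeMap S e)) y x :=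
    fun e x y => ⟨fun h => ⟨.of_mem h, .of_mem (by simpa using Subgroup.inv_mem _ h)⟩,
      fun h => h.1.mem_of_symm h.2⟩
  have hmem' : ∀ (e : R) (x y : Rˣ), x⁻¹ * y ∈ parabolic (typeMap S e) ↔
      cs.CosetLE (parabolic (typeMap S e)) y x ∧ cs.CosetLE (parabolic (typeMap S e)) x y :=
    fun e x y => (hmem e x y).trans and_comm
  rcases hle with rfl | rfl
  · have h : ∀ r s, AdhPlus Λ S r s → _ := fun _ _ => AdhPlus.lexRel hcs
    exact ⟨fun hJ => hR.greenJ_chain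
        (fun _ _ h' => (h _ _ h').mono fun _ _ _ _ _ _ => trivial) hchain hJ i,
      fun hends => hR.greenR_chain (fun _ _ _ _ => CosetLE.trans) hmem
        (fun _ _ h' => (h _ _ h').mono fun _ _ _ _ _ h => h.1) hchain hends i,
      fun hends => hR.greenL_chain (P := fun e x y => cs.CosetLE (parabolic (typeMap S e)) y x)
        (fun _ _ _ _ h h' => h'.trans h) hmem'
        (fun _ _ h' => (h _ _ h').mono fun _ _ _ _ _ h => h.2) hchain hends i⟩
  · have h : ∀ r s, AdhMinus Λ S r s → _ := fun _ _ => AdhMinus.lexRel hcs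
    exact ⟨fun hJ => hR.greenJ_chain
        (fun _ _ h' => (h _ _ h').mono fun _ _ _ _ _ _ => trivial) hchain hJ i,
      fun hends => hR.greenR_chain (P := fun e x y => cs.CosetLE (parabolic (typeMap S e)) y x)
        (fun _ _ _ _ h h' => h'.trans h) hmem'
        (fun _ _ h' => (h _ _ h').mono fun _ _ _ _ _ h => h.1) hchain hends i,
      fun hends => hR.greenL_chain (fun _ _ _ _ => CosetLE.trans) hmem
        (fun _ _ h' => (h _ _ h').mono fun _ _ _ _ _ h => h.2) hchain hends i⟩

end IsRennerCoxeterSystem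

end Green

end RennerCoxeter

theorem mainTheorem9 {R : Type*} [Monoid R] [Finite R] (Λ : Set R) (S : Set Rˣ)
    (hR : RennerCoxeter.IsRennerCoxeterSystem Λ S)
    (le : R → R → Prop)
    (hle : le = RennerCoxeter.AdhPlus Λ S ∨ le = RennerCoxeter.AdhMinus Λ S)
    (T : R → R → Prop)
    (hT : T = RennerCoxeter.GreenJ ∨ T = RennerCoxeter.GreenL ∨
      T = RennerCoxeter.GreenR ∨ T = RennerCoxeter.GreenH)
    (n : ℕ) (r : Fin (n + 1) → R)
    (hchain : ∀ i : Fin n, le (r i.castSucc) (r i.succ))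
    (hends : T (r 0) (r (Fin.last n))) :
    ∀ i : Fin (n + 1), T (r 0) (r i) := by
  intro i
  obtain ⟨hJ, hRR, hL⟩ := hR.green_chain_of_adherence hle hchain i
  rcases hT with rfl | rfl | rfl | rfl
  · exact hJ hends
  · exact hL hends
  · exact hRR hends
  · exact ⟨hL hends.1, hRR hends.2⟩
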